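/- Let $d\in\mathbb N$, $\beta>0$ and $\delta>0$. There is $T_0$, depending only on $d,\beta,\delta$, such that the following holds for every Bayesian logistic bandit as follows. The action set $\mathcal A\subset\mathbb R^d$ and the parameter set $\Theta=\{\theta^1,\dots,\theta^m\}\subset\mathbb R^d$ are finite and contained in the closed Euclidean unit ball; the true parameter $\theta^*$ is drawn from a prior on $\Theta$; playing action $a$ yields a reward $R(Y_a)=Y_a\in\{0,1\}$ which, given $\theta^*=\theta$, is Bernoulli with parameter $\mu(a,\theta)=\phi(a^\top\theta)$, where $\phi(x)=e^{\beta x}/(1+e^{\beta x})$; and $\alpha(\theta)\in\operatorname{argmax}_{a\in\mathcal A}\mu(a,\theta)$ is a fixed selection of optimal actions. Assume $\inf_{\theta\in\Theta}|\alpha(\theta)^\top\theta|=\delta$. In period $t$, Thompson sampling draws $\theta_t$ from the posterior of $\theta^*$ given $\mathcal H_{t-1}=(\theta_1,Y_{\alpha(\theta_1)},\dots,\theta_{t-1},Y_{\alpha(\theta_{t-1})})$ and plays $A_t=\alpha(\theta_t)$; its Bayesian regret is $\mathrm{BayesRegret}(T;\pi^{\mathrm{TS}})=\mathbb E\sum_{t=1}^T\big(\mu(\alpha(\theta^*),\theta^*)-R(Y_{A_t})\big)$.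 Assume also that the (conjectured) information-ratio bound holds for this bandit, namely: for every $\epsilon>0$, every partition $\Theta_1,\dots,\Theta_K$ of $\Theta$ with $\mu(\alpha(\theta'),\theta')-\mu(\alpha(\theta),\theta')\le\epsilon$ whenever $\theta,\theta'$ lie in the same block, with $\psi$ the index of the block that contains $\theta^*$, every $t\ge1$, and every random $\tilde\theta^*_t\in\Theta$ with a copy $\tilde\theta_t$ that, conditionally on $\mathcal H_{t-1}$, has the law of $\tilde\theta^*_t$ and is independent of $(\theta^*,\tilde\theta^*_t)$ (the outcomes $Y_a$ of period $t$ being independent of $(\tilde\theta^*_t,\tilde\theta_t)$ given $\theta^*$ and $\mathcal H_{t-1}$), if, almost surely, with $\mathbb E_{t-1}$ and $I_{t-1}$ denoting expectation and mutual information (in nats) conditional on $\mathcal H_{t-1}$, (i) $\tilde\theta^*_t$ is independent of $\theta^*$ given $\psi$ (and $\mathcal H_{t-1}$), (ii) $\mathbb E_{t-1}[\mu(\alpha(\theta^*),\theta^*)-R(Y_{\alpha(\theta_t)})]-\mathbb E_{t-1}[R(Y_{\alpha(\tilde\theta^*_t)})-R(Y_{\alpha(\tilde\theta_t)})]\le\epsilon$,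 and (iii) $I_{t-1}(\psi;(\tilde\theta_t,Y_{\alpha(\tilde\theta_t)}))\le I_{t-1}(\psi;(\theta_t,Y_{\alpha(\theta_t)}))$, then $$\Gamma_t(\tilde\theta^*_t;\tilde\theta_t)=\frac{\big(\mathbb E[R(Y_{\alpha(\tilde\theta^*_t)})-R(Y_{\alpha(\tilde\theta_t)})]\big)^2}{I\big(\tilde\theta^*_t;(\tilde\theta_t,Y_{\alpha(\tilde\theta_t)})\,\big|\,\mathcal H_{t-1}\big)}\le\frac d2$$ (with $0/0=0$). Then for all $T\ge T_0$, $$\mathrm{BayesRegret}(T;\pi^{\mathrm{TS}})\le 2d\sqrt{T\log\Big(3+\frac{6\sqrt{2T}}{d}\cdot\frac{\beta e^{\beta\delta}}{(1+e^{\beta\delta})^2}\Big)}\le 2d\sqrt{T\log\Big(3+\frac{3\sqrt{2T}}{2d}\min\{\delta^{-1},\beta\}\Big)}.$$ -/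

import Mathlib

open scoped ENNReal

noncomputable section

/-- The logistic link function with steepness `β`. -/
def logisticLink (β x : ℝ) : ℝ := Real.exp (β * x) / (1 + Real.exp (β * x))

/-- Mutual information (in nats) of the two coordinates of a finite joint probability mass
function `p`. Terms with `p a b = 0` vanish; if `p a b > 0`, both marginals are positive. -/
def mutualInfo {X Y : Type*} [Fintype X] [Fintype Y] (p : X → Y → ℝ) : ℝ :=
  ∑ a, ∑ b, p a b * Real.log (p a b / ((∑ b', p a b') * ∑ a', p a' b))

/-- A Bayesian logistic bandit in dimension `d` with steepness `β`: a finite set of actions, a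
finite family of parameters `θ¹, …, θᵐ` (repetitions allowed), a prior on the family, and a
selection `opt = α` of an optimal action under each parameter. -/
structure LogisticBandit (d : ℕ) (β : ℝ) where
  /-- the action set -/
  actions : Finset (EuclideanSpace ℝ (Fin d))
  /-- the number of parameters -/
  m : ℕ
  /-- the parameters -/
  param : Fin m → EuclideanSpace ℝ (Fin d)
  /-- the prior distribution of the true parameter -/
  prior : Fin m → ℝ
  prior_nonneg : ∀ i, 0 ≤ prior i
  prior_sum : ∑ i, prior i = 1
  /-- the optimal action `α(θⁱ)` -/
  opt : Fin m → EuclideanSpace ℝ (Fin d)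
  opt_mem : ∀ i, opt i ∈ actions
  opt_max : ∀ i, ∀ a ∈ actions,
    logisticLink β (inner ℝ a (param i)) ≤ logisticLink β (inner ℝ (opt i) (param i))

/-- The reward of a binary outcome (the outcome itself, as a real number). -/
def reward (y : Bool) : ℝ := if y then 1 else 0

namespace LogisticBandit

variable {d : ℕ} {β : ℝ} (B : LogisticBandit d β)

/-- Mean reward `μ(a, θⁱ) = φ(aᵀ θⁱ)`. -/
def mean (a : EuclideanSpace ℝ (Fin d)) (i : Fin B.m) : ℝ :=
  logisticLink β (inner ℝ a (B.param i))

/-- Probability of the outcome `y` of the action `a` under the parameter `θⁱ`: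
Bernoulli with parameter `μ(a, θⁱ)`. -/
def outcomeProb (a : EuclideanSpace ℝ (Fin d)) (i : Fin B.m) (y : Bool) : ℝ :=
  if y then B.mean a i else 1 - B.mean a i

/-- Histories `(θ₁, Y_{α(θ₁)}, …, θₙ, Y_{α(θₙ)})` of the first `n` periods: the sampled
parameter (by its index) and the outcome observed in each period. -/
abbrev History (n : ℕ) : Type := Fin n → Fin B.m × Bool

/-- Joint law of history and true parameter under Thompson sampling: the probability that the
history of the first `n` periods is `h` and that `θ* = θⁱ`. In each period a parameter is sampled
from the posterior of `θ*` given the history so far (independently of `θ*` given the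
history), its optimal action is played, and the outcome is drawn under `θ*`. -/
def jointLaw : (n : ℕ) → B.History n → Fin B.m → ℝ
  | 0, _, i => B.prior i
  | n + 1, h, i =>
      jointLaw n (Fin.init h) i
        * (jointLaw n (Fin.init h) (h (Fin.last n)).1 / ∑ k, jointLaw n (Fin.init h) k)
        * B.outcomeProb (B.opt (h (Fin.last n)).1) i (h (Fin.last n)).2

/-- Probability of a history under Thompson sampling. -/
def histProb {n : ℕ} (h : B.History n) : ℝ := ∑ i, B.jointLaw n h i

/-- Posterior probability of `θ* = θⁱ` given the history `h`. -/
def posterior {n : ℕ} (h : B.History n) (i : Fin B.m) : ℝ := B.jointLaw n h i / B.histProb h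

/-- Bayesian regret of Thompson sampling: the expectation of `∑_{t ≤ T} (R* - R(Y_{A_t}))`,
where `R* = μ(α(θ*), θ*)`. -/
def bayesRegret (T : ℕ) : ℝ :=
  ∑ h : B.History T, ∑ i, B.jointLaw T h i *
    ∑ t : Fin T, (B.mean (B.opt i) i - reward (h t).2)

/-- The distortion `d(θⁱ, θʲ) = μ(α(θʲ), θʲ) - μ(α(θⁱ), θʲ)`. -/
def distortion (i j : Fin B.m) : ℝ := B.mean (B.opt j) j - B.mean (B.opt i) j

/-- `ψ` assigns to each parameter its block in a partition of the parameters such that the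
distortion within each block is at most `ε`. -/
def IsPartition {K : ℕ} (ψ : Fin B.m → Fin K) (ε : ℝ) : Prop :=
  ∀ i j, ψ i = ψ j → B.distortion i j ≤ ε

/-! In the rest, all probabilities are conditional on a history `h` (of the first `t - 1`
periods). A random parameter `θ̃*` is given by its joint law with `θ*`:
`w i j = P(θ* = θⁱ, θ̃* = θʲ | h)`. The second parameter `θ̃` has the marginal law of `θ̃*` and is
independent of `(θ*, θ̃*)`. The noise in the outcomes is independent of `(θ̃*, θ̃)` given `θ*`. -/

/-- The marginal law of `θ̃*` (hence the law of `θ̃`). -/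
def marginal (w : Fin B.m → Fin B.m → ℝ) (j : Fin B.m) : ℝ := ∑ i, w i j

/-- `E[R(Y_{α(θ')}) | h]` for a random parameter `θ'` whose joint law with `θ*` is `w`. -/
def expReward (w : Fin B.m → Fin B.m → ℝ) : ℝ := ∑ i, ∑ j, w i j * B.mean (B.opt j) i

/-- `E[R(Y_{α(θ')}) | h]` for a random parameter `θ'` of law `q` independent of `θ*`. -/
def expRewardIndep {n : ℕ} (h : B.History n) (q : Fin B.m → ℝ) : ℝ :=
  B.expReward fun i j => B.posterior h i * q j

/-- `E[R* | h]`. -/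
def expOptReward {n : ℕ} (h : B.History n) : ℝ :=
  ∑ i, B.posterior h i * B.mean (B.opt i) i

/-- The mutual information of `ψ(θ*)` and `(θ', Y_{α(θ')})` given `h`, where `θ'` has law `q` and is
independent of `θ*`. -/
def blockInfo {n K : ℕ} (h : B.History n) (ψ : Fin B.m → Fin K) (q : Fin B.m → ℝ) : ℝ :=
  mutualInfo fun (k : Fin K) (jy : Fin B.m × Bool) =>
    ∑ i, if ψ i = k then B.posterior h i * q jy.1 * B.outcomeProb (B.opt jy.1) i jy.2 else 0

/-- The mutual information of `θ̃*` and `(θ̃, Y_{α(θ̃)})` given `h`. -/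
def paramInfo (w : Fin B.m → Fin B.m → ℝ) : ℝ :=
  mutualInfo fun (l : Fin B.m) (jy : Fin B.m × Bool) =>
    ∑ i, w i l * B.marginal w jy.1 * B.outcomeProb (B.opt jy.1) i jy.2

/-- `θ̃*`, given by the conditional joint laws `w h` of `(θ*, θ̃*)`, is a compressed version of `θ*`
for the partition `ψ` with tolerance `ε` (in period `n + 1`). -/
structure IsCompressed {n K : ℕ} (ψ : Fin B.m → Fin K) (ε : ℝ)
    (w : B.History n → Fin B.m → Fin B.m → ℝ) : Prop where
  nonneg : ∀ h, 0 < B.histProb h → ∀ i j, 0 ≤ w h i j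
  /-- the first coordinate has the law of `θ*` -/
  fst_law : ∀ h, 0 < B.histProb h → ∀ i, ∑ j, w h i j = B.posterior h i
  /-- `θ̃*` is independent of `θ*` conditionally on `ψ(θ*)`:
  `P(θ* = θⁱ, θ̃* = θʲ) P(ψ = ψ(θⁱ)) = P(θ* = θⁱ) P(θ̃* = θʲ, ψ = ψ(θⁱ))` -/
  condIndep : ∀ h, 0 < B.histProb h → ∀ i j,
    w h i j * (∑ i', if ψ i' = ψ i then B.posterior h i' else 0)
      = B.posterior h i * ∑ i', if ψ i' = ψ i then w h i' j else 0
  /-- `E[R* - R(Y_{α(θ_t)})] - E[R(Y_{α(θ̃*)}) - R(Y_{α(θ̃)})] ≤ ε`, where `θ_t` is the parameter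
  drawn by Thompson sampling -/
  regret_le : ∀ h, 0 < B.histProb h →
    (B.expOptReward h - B.expRewardIndep h (B.posterior h))
      - (B.expReward (w h) - B.expRewardIndep h (B.marginal (w h))) ≤ ε
  /-- `I(ψ; (θ̃, Y_{α(θ̃)})) ≤ I(ψ; (θ_t, Y_{α(θ_t)}))` -/
  info_le : ∀ h, 0 < B.histProb h →
    B.blockInfo h ψ (B.marginal (w h)) ≤ B.blockInfo h ψ (B.posterior h)

/-- The information ratio in period `n + 1`,
`Γ(θ̃*; θ̃) = E[R(Y_{α(θ̃*)}) - R(Y_{α(θ̃)})]² / I(θ̃*; (θ̃, Y_{α(θ̃)}) | history)`,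
an extended nonnegative real (`0 / 0 = 0`, and `x / 0 = ∞` for `x > 0`). -/
def infoRatio {n : ℕ} (w : B.History n → Fin B.m → Fin B.m → ℝ) : ℝ≥0∞ :=
  ENNReal.ofReal ((∑ h, B.histProb h *
      (B.expReward (w h) - B.expRewardIndep h (B.marginal (w h)))) ^ 2)
    / ENNReal.ofReal (∑ h, B.histProb h * B.paramInfo (w h))

/-- The conjectured information-ratio bound, for the bandit `B`: in every period, for every
partition and every compressed version `θ̃*` of `θ*`, the information ratio is at most `d / 2`. -/
def InfoRatioBound : Prop :=
  ∀ (ε : ℝ), 0 < ε → ∀ (K : ℕ) (ψ : Fin B.m → Fin K), B.IsPartition ψ ε →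
    ∀ (n : ℕ) (w : B.History n → Fin B.m → Fin B.m → ℝ), B.IsCompressed ψ ε w →
      B.infoRatio w ≤ (d : ℝ≥0∞) / 2

end LogisticBandit

end

/-! Let ψ be the block of θ*, and draw θ̃* from the posterior of θ* restricted to that block. Then
θ̃* has the same law as the Thompson sample θ_t. So the information condition of a compressed
version is an equality, and the regret condition only compares θ* with another point of its block,
at cost at most ε. Since θ̃* depends on the rest only through ψ, data processing bounds its
information by that of Thompson sampling about ψ (`paramInfo_resampleLaw_le`). The assumed ratio d/2
then gives a one-period regret of at most D + ε, with D² at most d/2 times the information gain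
about ψ (`exists_stepRegret_le`).

The gains telescope as entropy decrements with total at most log K (`sum_infoGain_le`), and
Cauchy–Schwarz gives regret at most √(T d log K / 2) + Tε (`bayesRegret_le`).

Mean rewards are β-Lipschitz in θ, so a grid of mesh 1/N yields K = (2N+1)^d and ε = 2βd/N. With N =
⌈√T⌉ the bound becomes d√T(√(log(2√T+3)/2) + 2β). Its leading term is d√T·√(log T)/2, while the
target grows like d√T·√(2 log T) whatever the constant C > 0 in log(3 + C√T). Hence in the first
inequality the slope of the link at δ affects only T₀. -/

section Information

/-! ### Log-sum and data processing inequalities. -/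

theorem sub_le_mul_log_div {a b : ℝ} (ha : 0 ≤ a) (hb : 0 ≤ b) (h : b = 0 → a = 0) :
    a - b ≤ a * Real.log (a / b) := by
  rcases ha.eq_or_lt with rfl | ha
  · simpa using hb
  have hb : 0 < b := hb.lt_of_ne fun h0 => ha.ne' (h h0.symm)
  have := mul_le_mul_of_nonneg_left (Real.one_sub_inv_le_log_of_pos (div_pos ha hb)) ha.le
  rwa [inv_div, mul_sub, mul_one, mul_div_cancel₀ _ ha.ne'] at this

/-- The log-sum inequality. -/
theorem sum_mul_log_sum_div_sum_le {ι : Type*} [Fintype ι] {a b : ι → ℝ} (ha : ∀ i, 0 ≤ a i)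
    (hb : ∀ i, 0 ≤ b i) (h : ∀ i, b i = 0 → a i = 0) :
    (∑ i, a i) * Real.log ((∑ i, a i) / ∑ i, b i) ≤ ∑ i, a i * Real.log (a i / b i) := by
  rcases (Finset.sum_nonneg fun i _ => ha i : 0 ≤ ∑ i, a i).eq_or_lt with h0 | hA
  · have hz := (Finset.sum_eq_zero_iff_of_nonneg fun i _ => ha i).1 h0.symm
    rw [← h0, zero_mul]
    exact (Finset.sum_eq_zero fun i hi => by rw [hz i hi, zero_mul]).ge
  have hB : 0 < ∑ i, b i := by
    refine (Finset.sum_nonneg fun i _ => hb i).lt_of_ne fun h0 => hA.ne' ?_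
    have hz := (Finset.sum_eq_zero_iff_of_nonneg fun i _ => hb i).1 h0.symm
    exact Finset.sum_eq_zero fun i hi => h i (hz i hi)
  set A := ∑ i, a i
  set D := ∑ i, b i
  -- Rescaling b to total mass A makes the left side sum to zero.
  have key : ∀ i, a i - b i * (A / D) ≤ a i * Real.log (a i / b i) - a i * Real.log (A / D) := by
    intro i
    have hAD := div_pos hA hB
    refine (sub_le_mul_log_div (ha i) (mul_nonneg (hb i) hAD.le) fun h0 =>
      h i ((mul_eq_zero.1 h0).resolve_right hAD.ne')).trans_eq ?_
    rcases (ha i).eq_or_lt with h0 | hai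
    · simp [← h0]
    have hbi : b i ≠ 0 := fun h0 => hai.ne' (h i h0)
    rw [← div_div, Real.log_div (div_pos hai ((hb i).lt_of_ne' hbi)).ne' hAD.ne', mul_sub]
  have := Finset.sum_le_sum fun i (_ : i ∈ Finset.univ) => key i
  rw [Finset.sum_sub_distrib, Finset.sum_sub_distrib, ← Finset.sum_mul, ← Finset.sum_mul] at this
  change A - D * (A / D) ≤ _ - A * _ at this
  rw [mul_div_cancel₀ _ hB.ne'] at this
  linarith

variable {X Y Z : Type*} [Fintype X] [Fintype Y] [Fintype Z]

theorem mutualInfo_nonneg {p : X → Y → ℝ} (hp : ∀ x y, 0 ≤ p x y) (h1 : ∑ x, ∑ y, p x y = 1) :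
    0 ≤ mutualInfo p := by
  have key : ∀ x y, p x y - (∑ y', p x y') * ∑ x', p x' y ≤
      p x y * Real.log (p x y / ((∑ y', p x y') * ∑ x', p x' y)) := by
    intro x y
    refine sub_le_mul_log_div (hp x y) (mul_nonneg (Finset.sum_nonneg fun _ _ => hp _ _)
      (Finset.sum_nonneg fun _ _ => hp _ _)) fun h0 => ?_
    rcases mul_eq_zero.1 h0 with h0 | h0
    · exact (Finset.sum_eq_zero_iff_of_nonneg fun _ _ => hp _ _).1 h0 y (Finset.mem_univ _)
    · exact (Finset.sum_eq_zero_iff_of_nonneg fun _ _ => hp _ _).1 h0 x (Finset.mem_univ _)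
  refine le_trans ?_ (Finset.sum_le_sum fun x _ => Finset.sum_le_sum fun y _ => key x y)
  simp_rw [Finset.sum_sub_distrib, ← Finset.mul_sum]
  rw [Finset.sum_comm (f := fun y x' => p x' y), ← Finset.sum_mul, h1]
  norm_num

/-- The data processing inequality: if `x` is obtained from `z` by a stochastic kernel `c`, then
`x` carries no more information on `y` than `z` does. -/
theorem mutualInfo_kernel_le {c : Z → X → ℝ} {p : Z → Y → ℝ} (hc : ∀ z x, 0 ≤ c z x)
    (hp : ∀ z y, 0 ≤ p z y) (h1 : ∀ z, ∑ y, p z y ≠ 0 → ∑ x, c z x = 1) :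
    mutualInfo (fun x y => ∑ z, c z x * p z y) ≤ mutualInfo p := by
  have hp0 : ∀ z, ∑ y, p z y = 0 → ∀ y, p z y = 0 := fun z h0 y =>
    (Finset.sum_eq_zero_iff_of_nonneg fun _ _ => hp _ _).1 h0 y (Finset.mem_univ _)
  have hcp : ∀ z t, (∑ y, p z y = 0 → t = 0) → ∑ x, c z x * t = t := by
    intro z t ht
    rw [← Finset.sum_mul]
    by_cases h0 : ∑ y, p z y = 0
    · rw [ht h0, mul_zero]
    · rw [h1 z h0, one_mul]
  have hx : ∀ x, ∑ y, ∑ z, c z x * p z y = ∑ z, c z x * ∑ y, p z y := by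
    intro x
    rw [Finset.sum_comm]
    simp_rw [Finset.mul_sum]
  have hy : ∀ y, ∑ x, ∑ z, c z x * p z y = ∑ z, p z y := by
    intro y
    rw [Finset.sum_comm]
    exact Finset.sum_congr rfl fun z _ => hcp z _ fun h0 => hp0 z h0 y
  have key : ∀ x y, (∑ z, c z x * p z y) *
      Real.log ((∑ z, c z x * p z y) / ((∑ z, c z x * ∑ y, p z y) * ∑ z, p z y)) ≤
      ∑ z, c z x * (p z y * Real.log (p z y / ((∑ y', p z y') * ∑ z', p z' y))) := by
    intro x y
    -- For fixed x and y this is the log-sum inequality over z; the weight `c z x` then cancels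
    -- inside the logarithm.
    rw [Finset.sum_mul (f := fun z => c z x * ∑ y, p z y)]
    refine (sum_mul_log_sum_div_sum_le (fun z => mul_nonneg (hc z x) (hp z y))
      (fun z => mul_nonneg (mul_nonneg (hc z x) (Finset.sum_nonneg fun _ _ => hp _ _))
        (Finset.sum_nonneg fun _ _ => hp _ _)) fun z h0 => ?_).trans_eq ?_
    · rcases mul_eq_zero.1 h0 with h0 | h0
      · rcases mul_eq_zero.1 h0 with h0 | h0
        · rw [h0, zero_mul]
        · rw [hp0 z h0, mul_zero]
      · rw [(Finset.sum_eq_zero_iff_of_nonneg fun _ _ => hp _ _).1 h0 z (Finset.mem_univ _),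
          mul_zero]
    · refine Finset.sum_congr rfl fun z _ => ?_
      by_cases h0 : c z x = 0
      · simp [h0]
      · rw [mul_assoc, mul_assoc, mul_div_mul_left _ _ h0]
  unfold mutualInfo
  simp_rw [hx, hy]
  refine (Finset.sum_le_sum fun x _ => Finset.sum_le_sum fun y _ => key x y).trans_eq ?_
  rw [Finset.sum_comm, Finset.sum_comm (s := (Finset.univ : Finset Z))]
  refine Finset.sum_congr rfl fun y _ => ?_
  rw [Finset.sum_comm]
  exact Finset.sum_congr rfl fun z _ => hcp z _ fun h0 => by rw [hp0 z h0, zero_mul]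

end Information

/-! ### The logistic link. -/

theorem logisticLink_nonneg (β x : ℝ) : 0 ≤ logisticLink β x := by
  unfold logisticLink; positivity

theorem logisticLink_le_one (β x : ℝ) : logisticLink β x ≤ 1 := by
  unfold logisticLink
  rw [div_le_one (by positivity)]
  linarith

/-- For u = exp(βx) ≥ v = exp(βy), the difference is (u - v)/((1+u)(1+v)) ≤ 1 - v/u ≤ log(u/v). The
sharp constant β/4 is not needed. -/
theorem logisticLink_sub_le {β : ℝ} (hβ : 0 ≤ β) (x y : ℝ) :
    logisticLink β x - logisticLink β y ≤ β * |x - y| := by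
  rcases le_total x y with h | h
  · have hm : logisticLink β x ≤ logisticLink β y := by
      unfold logisticLink
      rw [div_le_div_iff₀ (by positivity) (by positivity)]
      have := Real.exp_le_exp.2 (mul_le_mul_of_nonneg_left h hβ)
      linarith
    have : 0 ≤ β * |x - y| := by positivity
    linarith
  · have h1 := Real.one_sub_inv_le_log_of_pos (Real.exp_pos (β * x - β * y))
    rw [Real.log_exp, ← Real.exp_neg, neg_sub, Real.exp_sub] at h1
    rw [abs_of_nonneg (sub_nonneg.2 h), mul_sub]
    refine le_trans ?_ h1
    have hxy := Real.exp_le_exp.2 (mul_le_mul_of_nonneg_left h hβ)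
    have h0 := Real.exp_pos (β * y)
    unfold logisticLink
    generalize Real.exp (β * x) = u at *
    generalize Real.exp (β * y) = v at *
    have hu : 0 < u := by linarith
    rw [div_sub_div _ _ (by positivity) (by positivity), one_sub_div hu.ne',
      div_le_div_iff₀ (by positivity) hu]
    nlinarith [mul_pos hu h0, mul_nonneg (sub_nonneg.2 hxy) (add_pos one_pos h0).le,
      mul_nonneg (mul_nonneg (sub_nonneg.2 hxy) h0.le) hu.le]

/-! ### The law of histories and the one-period decomposition of regret. -/

namespace LogisticBandit

variable {d : ℕ} {β : ℝ} (B : LogisticBandit d β)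

theorem outcomeProb_nonneg (a : EuclideanSpace ℝ (Fin d)) (i : Fin B.m) (y : Bool) :
    0 ≤ B.outcomeProb a i y := by
  unfold outcomeProb mean
  split_ifs
  · exact logisticLink_nonneg _ _
  · exact sub_nonneg.2 (logisticLink_le_one _ _)

theorem sum_outcomeProb (a : EuclideanSpace ℝ (Fin d)) (i : Fin B.m) :
    ∑ y, B.outcomeProb a i y = 1 := by
  simp [outcomeProb]

theorem sum_outcomeProb_mul_reward (a : EuclideanSpace ℝ (Fin d)) (i : Fin B.m) :
    ∑ y, B.outcomeProb a i y * reward y = B.mean a i := by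
  simp [outcomeProb, reward]

theorem jointLaw_nonneg : ∀ (n : ℕ) (h : B.History n) (i : Fin B.m), 0 ≤ B.jointLaw n h i
  | 0, _, i => B.prior_nonneg i
  | n + 1, _, _ => mul_nonneg (mul_nonneg (jointLaw_nonneg n _ _)
      (div_nonneg (jointLaw_nonneg n _ _) (Finset.sum_nonneg fun _ _ => jointLaw_nonneg n _ _)))
      (B.outcomeProb_nonneg _ _ _)

variable {n : ℕ}

theorem histProb_nonneg (h : B.History n) : 0 ≤ B.histProb h :=
  Finset.sum_nonneg fun _ _ => B.jointLaw_nonneg _ _ _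

theorem jointLaw_eq_zero {h : B.History n} (h0 : B.histProb h = 0) (i : Fin B.m) :
    B.jointLaw n h i = 0 :=
  (Finset.sum_eq_zero_iff_of_nonneg fun _ _ => B.jointLaw_nonneg _ _ _).1 h0 i (Finset.mem_univ _)

theorem posterior_nonneg (h : B.History n) (i : Fin B.m) : 0 ≤ B.posterior h i :=
  div_nonneg (B.jointLaw_nonneg _ _ _) (B.histProb_nonneg h)

theorem histProb_mul_posterior (h : B.History n) (i : Fin B.m) :
    B.histProb h * B.posterior h i = B.jointLaw n h i := by
  by_cases h0 : B.histProb h = 0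
  · rw [h0, zero_mul, B.jointLaw_eq_zero h0]
  · exact mul_div_cancel₀ _ h0

theorem sum_posterior {h : B.History n} (h0 : B.histProb h ≠ 0) : ∑ i, B.posterior h i = 1 := by
  unfold posterior
  rw [← Finset.sum_div]
  exact div_self h0

/-- The history `h` followed by the sampled parameter and outcome `x`. -/
def extend (h : B.History n) (x : Fin B.m × Bool) : B.History (n + 1) :=
  Fin.snoc (α := fun _ => Fin B.m × Bool) h x

theorem jointLaw_extend (h : B.History n) (x : Fin B.m × Bool) (i : Fin B.m) :
    B.jointLaw (n + 1) (B.extend h x) i =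
      B.jointLaw n h i * B.posterior h x.1 * B.outcomeProb (B.opt x.1) i x.2 := by
  simp [jointLaw, extend, posterior, histProb]

theorem sum_history_succ (f : B.History (n + 1) → ℝ) :
    ∑ h, f h = ∑ h : B.History n, ∑ x, f (B.extend h x) := by
  rw [← (Fin.snocEquiv fun _ => Fin B.m × Bool).sum_comp, Fintype.sum_prod_type,
    Finset.sum_comm]
  rfl

theorem sum_posterior_mul_outcomeProb {h : B.History n} (h0 : B.histProb h ≠ 0) (i : Fin B.m) :
    ∑ x : Fin B.m × Bool, B.posterior h x.1 * B.outcomeProb (B.opt x.1) i x.2 = 1 := by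
  rw [Fintype.sum_prod_type]
  simp_rw [← Finset.mul_sum, sum_outcomeProb, mul_one]
  exact B.sum_posterior h0

theorem sum_jointLaw_extend (h : B.History n) (i : Fin B.m) :
    ∑ x, B.jointLaw (n + 1) (B.extend h x) i = B.jointLaw n h i := by
  simp_rw [jointLaw_extend, mul_assoc, ← Finset.mul_sum]
  by_cases h0 : B.histProb h = 0
  · rw [B.jointLaw_eq_zero h0, zero_mul]
  · rw [B.sum_posterior_mul_outcomeProb h0, mul_one]

theorem sum_histProb (n : ℕ) : ∑ h : B.History n, B.histProb h = 1 := by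
  induction n with
  | zero => simpa [histProb, jointLaw] using B.prior_sum
  | succ n ih =>
    rw [sum_history_succ, ← ih]
    refine Finset.sum_congr rfl fun h _ => ?_
    unfold histProb
    rw [Finset.sum_comm]
    exact Finset.sum_congr rfl fun i _ => B.sum_jointLaw_extend h i

/-- The expected regret of one period of Thompson sampling after the history `h`. -/
noncomputable def stepRegret (h : B.History n) : ℝ :=
  B.expOptReward h - B.expRewardIndep h (B.posterior h)

/-- Summing out the last period restores the previous joint law, so the earlier regret terms are
unchanged. -/
theorem bayesRegret_succ (T : ℕ) :
    B.bayesRegret (T + 1) =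
      B.bayesRegret T + ∑ h : B.History T, B.histProb h * B.stepRegret h := by
  unfold bayesRegret
  rw [sum_history_succ, ← Finset.sum_add_distrib]
  refine Finset.sum_congr rfl fun h _ => ?_
  have hsplit : ∀ x i, B.jointLaw (T + 1) (B.extend h x) i *
      ∑ t : Fin (T + 1), (B.mean (B.opt i) i - reward (B.extend h x t).2) =
      B.jointLaw (T + 1) (B.extend h x) i * ∑ t : Fin T, (B.mean (B.opt i) i - reward (h t).2) +
      (B.jointLaw (T + 1) (B.extend h x) i * B.mean (B.opt i) i -
        B.jointLaw (T + 1) (B.extend h x) i * reward x.2) := by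
    intro x i
    rw [Fin.sum_univ_castSucc, mul_add, ← mul_sub]
    simp [extend]
  simp_rw [hsplit, Finset.sum_add_distrib, Finset.sum_sub_distrib]
  have h1 : ∀ g : Fin B.m → ℝ, ∑ x, ∑ i, B.jointLaw (T + 1) (B.extend h x) i * g i =
      ∑ i, B.jointLaw T h i * g i := by
    intro g
    rw [Finset.sum_comm]
    simp_rw [← Finset.sum_mul, sum_jointLaw_extend]
  rw [h1, h1]
  congr 1
  unfold stepRegret expOptReward expRewardIndep expReward
  rw [mul_sub, Finset.mul_sum, Finset.mul_sum]
  simp_rw [← mul_assoc, histProb_mul_posterior, Finset.mul_sum, ← mul_assoc,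
    histProb_mul_posterior]
  congr 1
  rw [Finset.sum_comm]
  refine Finset.sum_congr rfl fun i _ => ?_
  rw [Fintype.sum_prod_type]
  refine Finset.sum_congr rfl fun j _ => ?_
  simp_rw [jointLaw_extend, mul_assoc, ← Finset.mul_sum, sum_outcomeProb_mul_reward]

theorem bayesRegret_eq_sum (T : ℕ) :
    B.bayesRegret T = ∑ t ∈ Finset.range T, ∑ h : B.History t, B.histProb h * B.stepRegret h := by
  induction T with
  | zero => simp [bayesRegret]
  | succ T ih => rw [bayesRegret_succ, ih, Finset.sum_range_succ]

/-! ### Entropy of the block and telescoping information gains. -/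

variable {K : ℕ}

/-- The joint probability of the history `h` and of `ψ(θ*) = k`. -/
noncomputable def blockJoint (ψ : Fin B.m → Fin K) (h : B.History n) (k : Fin K) : ℝ :=
  ∑ i, if ψ i = k then B.jointLaw n h i else 0

theorem blockJoint_nonneg (ψ : Fin B.m → Fin K) (h : B.History n) (k : Fin K) :
    0 ≤ B.blockJoint ψ h k := by
  refine Finset.sum_nonneg fun i _ => ?_
  split_ifs
  exacts [B.jointLaw_nonneg _ _ _, le_rfl]

theorem sum_blockJoint (ψ : Fin B.m → Fin K) (h : B.History n) :
    ∑ k, B.blockJoint ψ h k = B.histProb h := by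
  unfold blockJoint histProb
  rw [Finset.sum_comm]
  simp

theorem blockJoint_le_histProb (ψ : Fin B.m → Fin K) (h : B.History n) (k : Fin K) :
    B.blockJoint ψ h k ≤ B.histProb h := by
  rw [← B.sum_blockJoint ψ]
  exact Finset.single_le_sum (fun k _ => B.blockJoint_nonneg ψ h k) (Finset.mem_univ k)

theorem sum_blockJoint_extend (ψ : Fin B.m → Fin K) (h : B.History n) (k : Fin K) :
    ∑ x, B.blockJoint ψ (B.extend h x) k = B.blockJoint ψ h k := by
  unfold blockJoint
  rw [Finset.sum_comm]
  refine Finset.sum_congr rfl fun i _ => ?_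
  split_ifs
  · exact B.sum_jointLaw_extend h i
  · simp

/-- The conditional entropy of `ψ(θ*)` given the history of the first `n` periods. -/
noncomputable def condEntropy (ψ : Fin B.m → Fin K) (n : ℕ) : ℝ :=
  -∑ h : B.History n, ∑ k, B.blockJoint ψ h k * Real.log (B.blockJoint ψ h k / B.histProb h)

theorem condEntropy_nonneg (ψ : Fin B.m → Fin K) (n : ℕ) : 0 ≤ B.condEntropy ψ n :=
  neg_nonneg.2 <| Finset.sum_nonpos fun h _ => Finset.sum_nonpos fun k _ =>
    mul_nonpos_of_nonneg_of_nonpos (B.blockJoint_nonneg ψ h k) <|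
      Real.log_nonpos (div_nonneg (B.blockJoint_nonneg ψ h k) (B.histProb_nonneg h)) <|
        div_le_one_of_le₀ (B.blockJoint_le_histProb ψ h k) (B.histProb_nonneg h)

theorem condEntropy_le_log (ψ : Fin B.m → Fin K) (n : ℕ) : B.condEntropy ψ n ≤ Real.log K := by
  have key : ∀ h : B.History n, B.histProb h * -Real.log K ≤
      ∑ k, B.blockJoint ψ h k * Real.log (B.blockJoint ψ h k / B.histProb h) := by
    intro h
    -- Log-sum inequality against K equal weights `histProb h`.
    refine le_of_eq_of_le ?_ (sum_mul_log_sum_div_sum_le (B.blockJoint_nonneg ψ h)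
      (fun _ => B.histProb_nonneg h) fun k h0 =>
        ((B.blockJoint_le_histProb ψ h k).trans_eq h0).antisymm (B.blockJoint_nonneg ψ h k))
    rw [sum_blockJoint, Finset.sum_const, Finset.card_univ, Fintype.card_fin, nsmul_eq_mul]
    by_cases h0 : B.histProb h = 0
    · rw [h0, zero_mul, zero_mul]
    · rw [div_mul_cancel_right₀ h0, Real.log_inv]
  have := Finset.sum_le_sum fun h (_ : h ∈ Finset.univ) => key h
  rw [← Finset.sum_mul, sum_histProb] at this
  unfold condEntropy
  linarith

theorem sum_ite_posterior_mul (ψ : Fin B.m → Fin K) (h : B.History n) (k : Fin K)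
    (x : Fin B.m × Bool) :
    (∑ i, if ψ i = k then
      B.posterior h i * B.posterior h x.1 * B.outcomeProb (B.opt x.1) i x.2 else 0) =
      B.blockJoint ψ (B.extend h x) k / B.histProb h := by
  unfold blockJoint
  rw [Finset.sum_div]
  refine Finset.sum_congr rfl fun i _ => ?_
  split_ifs
  · rw [jointLaw_extend]
    unfold posterior
    ring
  · rw [zero_div]

/-- Chain rule on one history: the information gained is the block entropy before the next
observation minus the one after it. Unnormalised weights make the terms telescope over histories. -/
theorem histProb_mul_blockInfo (ψ : Fin B.m → Fin K) (h : B.History n) :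
    B.histProb h * B.blockInfo h ψ (B.posterior h) =
      (∑ x, ∑ k, B.blockJoint ψ (B.extend h x) k *
        Real.log (B.blockJoint ψ (B.extend h x) k / B.histProb (B.extend h x))) -
      ∑ k, B.blockJoint ψ h k * Real.log (B.blockJoint ψ h k / B.histProb h) := by
  have hle : ∀ x k, B.blockJoint ψ (B.extend h x) k ≤ B.blockJoint ψ h k := fun x k => by
    rw [← B.sum_blockJoint_extend ψ h k]
    exact Finset.single_le_sum (fun x _ => B.blockJoint_nonneg ψ (B.extend h x) k)
      (Finset.mem_univ x)
  unfold blockInfo mutualInfo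
  simp_rw [sum_ite_posterior_mul, ← Finset.sum_div, sum_blockJoint, sum_blockJoint_extend]
  rw [Finset.sum_comm (s := (Finset.univ : Finset (Fin B.m × Bool))), ← Finset.sum_sub_distrib,
    Finset.mul_sum]
  refine Finset.sum_congr rfl fun k _ => ?_
  -- Only the factor outside the logarithm stays expanded over the next observation, so that both
  -- sides match term by term.
  rw [← B.sum_blockJoint_extend ψ h k, Finset.sum_mul, ← Finset.sum_sub_distrib, Finset.mul_sum,
    B.sum_blockJoint_extend ψ h k]
  refine Finset.sum_congr rfl fun x _ => ?_
  rcases (B.blockJoint_nonneg ψ (B.extend h x) k).eq_or_lt with h0 | h0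
  · simp [← h0]
  have h1 := h0.trans_le (hle x k)
  have h2 := h1.trans_le (B.blockJoint_le_histProb ψ h k)
  have h3 := h0.trans_le (B.blockJoint_le_histProb ψ (B.extend h x) k)
  rw [← mul_sub, ← Real.log_div (div_pos h0 h3).ne' (div_pos h1 h2).ne', ← mul_assoc,
    mul_div_cancel₀ _ h2.ne']
  congr 2
  field_simp

/-- The expected information gain on `ψ(θ*)` in period `n + 1`. -/
noncomputable def infoGain (ψ : Fin B.m → Fin K) (n : ℕ) : ℝ :=
  ∑ h : B.History n, B.histProb h * B.blockInfo h ψ (B.posterior h)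

theorem infoGain_eq (ψ : Fin B.m → Fin K) (n : ℕ) :
    B.infoGain ψ n = B.condEntropy ψ n - B.condEntropy ψ (n + 1) := by
  unfold infoGain condEntropy
  simp_rw [histProb_mul_blockInfo]
  rw [Finset.sum_sub_distrib, sum_history_succ]
  ring

theorem sum_infoGain_le (ψ : Fin B.m → Fin K) (T : ℕ) :
    ∑ t ∈ Finset.range T, B.infoGain ψ t ≤ Real.log K := by
  simp_rw [infoGain_eq]
  rw [Finset.sum_range_sub']
  linarith [B.condEntropy_nonneg ψ T, B.condEntropy_le_log ψ 0]

theorem infoGain_nonneg (ψ : Fin B.m → Fin K) (n : ℕ) : 0 ≤ B.infoGain ψ n := by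
  refine Finset.sum_nonneg fun h _ => ?_
  by_cases h0 : B.histProb h = 0
  · rw [h0, zero_mul]
  refine mul_nonneg (B.histProb_nonneg h) (mutualInfo_nonneg (fun k x => ?_) ?_)
  · rw [sum_ite_posterior_mul]
    exact div_nonneg (B.blockJoint_nonneg _ _ _) (B.histProb_nonneg h)
  · simp_rw [sum_ite_posterior_mul, ← Finset.sum_div, sum_blockJoint_extend, sum_blockJoint]
    exact div_self h0

/-! ### Compression by resampling within the block. -/

/-- The posterior probability of `ψ(θ*) = k`. -/
noncomputable def blockMass (ψ : Fin B.m → Fin K) (h : B.History n) (k : Fin K) : ℝ :=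
  ∑ i, if ψ i = k then B.posterior h i else 0

theorem posterior_eq_zero_of_blockMass {ψ : Fin B.m → Fin K} {h : B.History n} {k : Fin K}
    (h0 : B.blockMass ψ h k = 0) {i : Fin B.m} (hi : ψ i = k) : B.posterior h i = 0 := by
  have := (Finset.sum_eq_zero_iff_of_nonneg (fun i _ => by
    split_ifs
    exacts [B.posterior_nonneg h i, le_rfl])).1 h0 i (Finset.mem_univ i)
  rwa [if_pos hi] at this

theorem blockMass_nonneg (ψ : Fin B.m → Fin K) (h : B.History n) (k : Fin K) :
    0 ≤ B.blockMass ψ h k := by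
  refine Finset.sum_nonneg fun i _ => ?_
  split_ifs
  exacts [B.posterior_nonneg h i, le_rfl]

/-- The posterior law of `θ*` given that `ψ(θ*) = k`. -/
noncomputable def blockLaw (ψ : Fin B.m → Fin K) (h : B.History n) (k : Fin K) (j : Fin B.m) : ℝ :=
  if ψ j = k then B.posterior h j / B.blockMass ψ h k else 0

theorem blockLaw_nonneg (ψ : Fin B.m → Fin K) (h : B.History n) (k : Fin K) (j : Fin B.m) :
    0 ≤ B.blockLaw ψ h k j := by
  unfold blockLaw
  split_ifs
  exacts [div_nonneg (B.posterior_nonneg h j) (B.blockMass_nonneg ψ h k), le_rfl]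

theorem sum_blockLaw {ψ : Fin B.m → Fin K} {h : B.History n} {k : Fin K}
    (h0 : B.blockMass ψ h k ≠ 0) : ∑ j, B.blockLaw ψ h k j = 1 := by
  rw [← div_self h0]
  unfold blockLaw
  conv_rhs => arg 1; unfold blockMass
  rw [Finset.sum_div]
  exact Finset.sum_congr rfl fun j _ => by split_ifs <;> simp

/-- The joint law of `θ*` and a parameter drawn from the posterior law of `θ*` given `ψ(θ*)`,
independently of `θ*` given `ψ(θ*)`. -/
noncomputable def resampleLaw (ψ : Fin B.m → Fin K) (h : B.History n) (i j : Fin B.m) : ℝ :=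
  B.posterior h i * B.blockLaw ψ h (ψ i) j

theorem resampleLaw_nonneg (ψ : Fin B.m → Fin K) (h : B.History n) (i j : Fin B.m) :
    0 ≤ B.resampleLaw ψ h i j :=
  mul_nonneg (B.posterior_nonneg h i) (B.blockLaw_nonneg ψ h _ j)

theorem sum_resampleLaw (ψ : Fin B.m → Fin K) (h : B.History n) (i : Fin B.m) :
    ∑ j, B.resampleLaw ψ h i j = B.posterior h i := by
  unfold resampleLaw
  rw [← Finset.mul_sum]
  by_cases h0 : B.blockMass ψ h (ψ i) = 0
  · rw [B.posterior_eq_zero_of_blockMass h0 rfl, zero_mul]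
  · rw [B.sum_blockLaw h0, mul_one]

theorem sum_ite_resampleLaw (ψ : Fin B.m → Fin K) (h : B.History n) (k : Fin K) (j : Fin B.m) :
    (∑ i, if ψ i = k then B.resampleLaw ψ h i j else 0) =
      B.blockMass ψ h k * B.blockLaw ψ h k j := by
  unfold blockMass
  rw [Finset.sum_mul]
  refine Finset.sum_congr rfl fun i _ => ?_
  split_ifs with hi
  · rw [resampleLaw, hi]
  · rw [zero_mul]

/-- Drawing a block and then a point within it by the conditional posterior reproduces the
posterior, so θ̃ is distributed as θ_t. -/
theorem marginal_resampleLaw (ψ : Fin B.m → Fin K) (h : B.History n) :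
    B.marginal (B.resampleLaw ψ h) = B.posterior h := by
  funext j
  have h1 : B.marginal (B.resampleLaw ψ h) j =
      ∑ i, if ψ i = ψ j then B.resampleLaw ψ h i j else 0 := by
    refine Finset.sum_congr rfl fun i _ => ?_
    split_ifs with hi
    · rfl
    · rw [resampleLaw, blockLaw, if_neg (Ne.symm hi), mul_zero]
  rw [h1, sum_ite_resampleLaw, blockLaw, if_pos rfl]
  by_cases h0 : B.blockMass ψ h (ψ j) = 0
  · rw [h0, zero_mul, B.posterior_eq_zero_of_blockMass h0 rfl]
  · exact mul_div_cancel₀ _ h0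

theorem isCompressed_resampleLaw {ψ : Fin B.m → Fin K} {ε : ℝ} (hψ : B.IsPartition ψ ε) :
    B.IsCompressed ψ ε (fun h : B.History n => B.resampleLaw ψ h) where
  nonneg h _ i j := B.resampleLaw_nonneg ψ h i j
  fst_law h _ i := B.sum_resampleLaw ψ h i
  condIndep h _ i j := by
    rw [sum_ite_resampleLaw, resampleLaw]
    change _ * B.blockMass ψ h (ψ i) = _
    ring
  regret_le h hh := by
    -- The two rewards of independent draws cancel, leaving the expected distortion between θ* and a
    -- parameter of its block.
    rw [marginal_resampleLaw, sub_sub_sub_cancel_right]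
    unfold expOptReward expReward
    simp_rw [← B.sum_resampleLaw ψ h, Finset.sum_mul]
    rw [← Finset.sum_sub_distrib]
    simp_rw [← Finset.sum_sub_distrib, ← mul_sub]
    have h1 : ∑ i, ∑ j, B.resampleLaw ψ h i j * ε = ε := by
      simp_rw [← Finset.sum_mul, sum_resampleLaw]
      rw [B.sum_posterior hh.ne', one_mul]
    refine (Finset.sum_le_sum fun i _ => Finset.sum_le_sum fun j _ => ?_).trans_eq h1
    by_cases hij : ψ j = ψ i
    · exact mul_le_mul_of_nonneg_left (hψ j i hij) (B.resampleLaw_nonneg ψ h i j)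
    · rw [resampleLaw, blockLaw, if_neg hij]
      simp
  info_le h _ := by rw [marginal_resampleLaw]

/-- Data processing for the kernel `blockLaw` from ψ to θ̃*. Its rows vanish on blocks of posterior
mass zero, which `mutualInfo_kernel_le` allows. -/
theorem paramInfo_resampleLaw_le (ψ : Fin B.m → Fin K) (h : B.History n) :
    B.paramInfo (B.resampleLaw ψ h) ≤ B.blockInfo h ψ (B.posterior h) := by
  unfold paramInfo blockInfo
  rw [marginal_resampleLaw]
  set p : Fin K → Fin B.m × Bool → ℝ := fun k x => ∑ i, if ψ i = k then
    B.posterior h i * B.posterior h x.1 * B.outcomeProb (B.opt x.1) i x.2 else 0 with hp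
  have h1 : (fun (l : Fin B.m) (x : Fin B.m × Bool) => ∑ i, B.resampleLaw ψ h i l *
      B.posterior h x.1 * B.outcomeProb (B.opt x.1) i x.2) =
      fun l x => ∑ k, B.blockLaw ψ h k l * p k x := by
    funext l x
    simp_rw [hp, Finset.mul_sum]
    rw [Finset.sum_comm]
    refine Finset.sum_congr rfl fun i _ => ?_
    simp only [mul_ite, mul_zero, Finset.sum_ite_eq, Finset.mem_univ, if_true]
    rw [resampleLaw]
    ring
  rw [h1]
  refine mutualInfo_kernel_le (B.blockLaw_nonneg ψ h) (fun k x => ?_) fun k hk =>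
    B.sum_blockLaw fun h0 => hk (Finset.sum_eq_zero fun x _ => Finset.sum_eq_zero fun i _ => ?_)
  · rw [hp]
    dsimp only
    rw [sum_ite_posterior_mul]
    exact div_nonneg (B.blockJoint_nonneg _ _ _) (B.histProb_nonneg h)
  · split_ifs with hi
    · rw [B.posterior_eq_zero_of_blockMass h0 hi, zero_mul, zero_mul]
    · rfl

/-! ### From the information ratio to the regret bound. -/

/-- As x / 0 = ∞ for x > 0, a finite ratio forces D = 0 when the denominator vanishes, so it can be
cleared without a case split. -/
theorem sq_le_of_infoRatio_le {w : B.History n → Fin B.m → Fin B.m → ℝ} {D I G : ℝ}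
    (hD : D = ∑ h, B.histProb h *
      (B.expReward (w h) - B.expRewardIndep h (B.marginal (w h))))
    (hI : I = ∑ h, B.histProb h * B.paramInfo (w h)) (hIG : I ≤ G) (hG : 0 ≤ G)
    (hw : B.infoRatio w ≤ (d : ℝ≥0∞) / 2) : D ^ 2 ≤ d / 2 * G := by
  unfold infoRatio at hw
  rw [← hD, ← hI] at hw
  have hd : (d : ℝ≥0∞) / 2 = ENNReal.ofReal (d / 2) := by
    rw [ENNReal.ofReal_div_of_pos two_pos]
    simp
  have hw' := (ENNReal.div_le_iff_le_mul (Or.inr (by rw [hd]; exact ENNReal.ofReal_ne_top))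
    (Or.inl ENNReal.ofReal_ne_top)).1 hw
  have h1 := hw'.trans (mul_le_mul_right (ENNReal.ofReal_le_ofReal hIG) _)
  rw [hd, ← ENNReal.ofReal_mul (by positivity)] at h1
  exact (ENNReal.ofReal_le_ofReal_iff (by positivity)).1 h1

/-- The per-period compression bound behind the regret analysis. -/
theorem exists_stepRegret_le (hB : B.InfoRatioBound) {ψ : Fin B.m → Fin K} {ε : ℝ} (hε : 0 < ε)
    (hψ : B.IsPartition ψ ε) (n : ℕ) :
    ∃ D : ℝ, D ^ 2 ≤ d / 2 * B.infoGain ψ n ∧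
      ∑ h : B.History n, B.histProb h * B.stepRegret h ≤ D + ε := by
  have hc := B.isCompressed_resampleLaw (n := n) hψ
  refine ⟨_, B.sq_le_of_infoRatio_le rfl rfl (Finset.sum_le_sum fun h _ =>
    mul_le_mul_of_nonneg_left (B.paramInfo_resampleLaw_le ψ h) (B.histProb_nonneg h))
    (B.infoGain_nonneg ψ n) (hB ε hε K ψ hψ n _ hc), ?_⟩
  rw [← one_mul ε, ← B.sum_histProb n, Finset.sum_mul, ← Finset.sum_add_distrib]
  refine Finset.sum_le_sum fun h _ => ?_
  rw [← mul_add]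
  rcases (B.histProb_nonneg h).eq_or_lt with h0 | h0
  · rw [← h0, zero_mul, zero_mul]
  · refine mul_le_mul_of_nonneg_left ?_ h0.le
    have := hc.regret_le h h0
    unfold stepRegret
    linarith

theorem bayesRegret_le (hB : B.InfoRatioBound) {ψ : Fin B.m → Fin K} {ε : ℝ} (hε : 0 < ε)
    (hψ : B.IsPartition ψ ε) (T : ℕ) :
    B.bayesRegret T ≤ √(T * (d / 2 * Real.log K)) + T * ε := by
  choose D hD hR using B.exists_stepRegret_le hB hε hψ
  rw [bayesRegret_eq_sum]
  refine (Finset.sum_le_sum fun t _ => hR t).trans ?_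
  rw [Finset.sum_add_distrib, Finset.sum_const, Finset.card_range, nsmul_eq_mul]
  gcongr
  -- Cauchy–Schwarz; the sign of `D t` plays no role.
  refine Real.le_sqrt_of_sq_le (sq_sum_le_card_mul_sum_sq.trans ?_)
  rw [Finset.card_range]
  gcongr
  refine (Finset.sum_le_sum fun t _ => hD t).trans ?_
  rw [← Finset.mul_sum]
  gcongr
  exact B.sum_infoGain_le ψ T

/-! ### Grid partitions of the parameter set. -/

/-- Insert the mean rewards of both actions under θⁱ: their difference is signed by optimality of
`opt i`, and the two remaining differences each keep the action fixed, hence are Lipschitz. -/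
theorem distortion_le (hβ : 0 ≤ β) (ha : ∀ a ∈ B.actions, ‖a‖ ≤ 1) (i j : Fin B.m) :
    B.distortion i j ≤ 2 * β * ‖B.param i - B.param j‖ := by
  have hin : ∀ a ∈ B.actions, ∀ x y : EuclideanSpace ℝ (Fin d),
      logisticLink β (inner ℝ a x) - logisticLink β (inner ℝ a y) ≤ β * ‖x - y‖ := by
    intro a haA x y
    refine (logisticLink_sub_le hβ _ _).trans (mul_le_mul_of_nonneg_left ?_ hβ)
    rw [← inner_sub_right]
    refine (abs_real_inner_le_norm _ _).trans ?_
    exact mul_le_of_le_one_left (norm_nonneg _) (ha a haA)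
  have h1 := hin _ (B.opt_mem j) (B.param j) (B.param i)
  have h2 := hin _ (B.opt_mem i) (B.param i) (B.param j)
  have h3 := B.opt_max i _ (B.opt_mem j)
  rw [norm_sub_rev] at h1
  unfold distortion mean
  linarith

/-- A grid of mesh `1 / N` gives a partition into `(2 N + 1) ^ d` blocks. -/
theorem exists_isPartition (hβ : 0 ≤ β) (ha : ∀ a ∈ B.actions, ‖a‖ ≤ 1)
    (hθ : ∀ i, ‖B.param i‖ ≤ 1) {N : ℕ} (hN : 0 < N) :
    ∃ ψ : Fin B.m → Fin ((2 * N + 1) ^ d), B.IsPartition ψ (2 * β * (d / N)) := by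
  have hc : ∀ i c, |B.param i c| ≤ 1 := fun i c =>
    (PiLp.norm_apply_le (B.param i) c).trans (hθ i)
  have hN' : (0 : ℝ) < N := Nat.cast_pos.2 hN
  have hcell : ∀ i c, ⌊N * (B.param i c + 1)⌋₊ < 2 * N + 1 := by
    intro i c
    -- The rescaled coordinate lies in [0, 2N] with the right endpoint attainable, hence 2N + 1
    -- cells.
    refine Nat.lt_succ_of_le (Nat.floor_le_of_le ?_)
    push_cast
    nlinarith [(abs_le.1 (hc i c)).2]
  refine ⟨fun i => finFunctionFinEquiv fun c => ⟨_, hcell i c⟩, fun i j hij => ?_⟩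
  have hij' := finFunctionFinEquiv.injective hij
  refine (B.distortion_le hβ ha i j).trans (mul_le_mul_of_nonneg_left ?_ (by positivity))
  have hcoord : ∀ c, ‖(B.param i - B.param j) c‖ ≤ 1 / N := by
    intro c
    have hfl : ⌊N * (B.param i c + 1)⌋₊ = ⌊N * (B.param j c + 1)⌋₊ :=
      congrArg Fin.val (congrFun hij' c)
    have hnn : ∀ i, 0 ≤ N * (B.param i c + 1) := fun i =>
      mul_nonneg hN'.le (by linarith [(abs_le.1 (hc i c)).1])
    have h1 := Nat.floor_le (hnn i)
    have h2 := Nat.lt_floor_add_one (N * (B.param i c + 1))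
    have h3 := Nat.floor_le (hnn j)
    have h4 := Nat.lt_floor_add_one (N * (B.param j c + 1))
    rw [hfl] at h1 h2
    rw [PiLp.sub_apply, Real.norm_eq_abs, le_div_iff₀ hN', ← abs_of_pos hN', ← abs_mul]
    exact abs_le.2 ⟨by linarith, by linarith⟩
  rw [EuclideanSpace.norm_eq]
  refine Real.sqrt_le_iff.2 ⟨by positivity, ?_⟩
  refine (Finset.sum_le_sum fun c _ => pow_le_pow_left₀ (norm_nonneg _) (hcoord c) 2).trans ?_
  rw [Finset.sum_const, Finset.card_univ, Fintype.card_fin, nsmul_eq_mul, div_pow, div_pow,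
    one_pow, mul_one_div]
  gcongr
  -- The diameter √d / N is relaxed to d / N through d ≤ d².
  exact_mod_cast Nat.le_self_pow two_ne_zero d

end LogisticBandit

/-! ### Numerical estimates and conclusion. -/

/-- The tangent of exp at 2 log 2, where its slope is 4, gives 4x ≤ 2 + exp x; multiply by exp x. -/
theorem four_mul_mul_exp_le (x : ℝ) : 4 * (x * Real.exp x) ≤ (1 + Real.exp x) ^ 2 := by
  have h1 := Real.add_one_le_exp (x - 2 * Real.log 2)
  have h4 : Real.exp (2 * Real.log 2) = 4 := by
    rw [two_mul, Real.exp_add, Real.exp_log two_pos]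
    norm_num
  rw [Real.exp_sub, h4] at h1
  have h2 : 4 * x ≤ 2 + Real.exp x := by linarith [Real.log_two_lt_d9]
  nlinarith [mul_le_mul_of_nonneg_right h2 (Real.exp_pos x).le]

theorem logisticSlope_le {β δ : ℝ} (hβ : 0 < β) (hδ : 0 < δ) :
    β * Real.exp (β * δ) / (1 + Real.exp (β * δ)) ^ 2 ≤ 1 / 4 * min δ⁻¹ β := by
  have hE := Real.exp_pos (β * δ)
  rw [mul_min_of_nonneg _ _ (by norm_num)]
  refine le_min ?_ ?_
  · rw [div_le_iff₀ (by positivity), ← mul_le_mul_iff_right₀ hδ]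
    have := four_mul_mul_exp_le (β * δ)
    have h2 : δ * (1 / 4 * δ⁻¹ * (1 + Real.exp (β * δ)) ^ 2) =
      1 / 4 * (1 + Real.exp (β * δ)) ^ 2 := by field_simp
    rw [h2]
    linarith
  · rw [div_le_iff₀ (by positivity)]
    nlinarith [mul_nonneg hβ.le (sq_nonneg (1 - Real.exp (β * δ)))]

/-- Here u stands for √T. Once C²u ≥ 2, (3 + Cu)² exceeds 2u + 3; once Cu ≥ exp(4β²), the root
absorbs 2β. -/
theorem sqrt_log_add_le {u C β : ℝ} (hC : 0 < C) (h1 : 2 / C ^ 2 ≤ u)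
    (h2 : Real.exp (4 * β ^ 2) / C ≤ u) :
    √(Real.log (2 * u + 3) / 2) + 2 * β ≤ 2 * √(Real.log (3 + C * u)) := by
  have hu : 0 < u := lt_of_lt_of_le (by positivity) h1
  have hv : 2 ≤ u * C ^ 2 := (div_le_iff₀ (by positivity)).1 h1
  have hw : Real.exp (4 * β ^ 2) ≤ u * C := (div_le_iff₀ hC).1 h2
  have hCu : 0 < C * u := mul_pos hC hu
  have hlog : Real.log (2 * u + 3) ≤ 2 * Real.log (3 + C * u) := by
    rw [← Nat.cast_two (R := ℝ), ← Real.log_pow]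
    refine Real.log_le_log (by positivity) ?_
    push_cast
    nlinarith [mul_le_mul_of_nonneg_left hv hu.le]
  have ha : √(Real.log (2 * u + 3) / 2) ≤ √(Real.log (3 + C * u)) :=
    Real.sqrt_le_sqrt (by linarith)
  have hb : 2 * β ≤ √(Real.log (3 + C * u)) := by
    refine Real.le_sqrt_of_sq_le ?_
    rw [Real.le_log_iff_exp_le (by positivity)]
    ring_nf at hw ⊢
    linarith
  linarith

theorem theorem4 (d : ℕ) (β δ : ℝ) (hβ : 0 < β) (hδ : 0 < δ) :
    ∃ T₀ : ℕ, ∀ B : LogisticBandit d β,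
      (∀ a ∈ B.actions, ‖a‖ ≤ 1) →
      (∀ i, ‖B.param i‖ ≤ 1) →
      (⨅ i, |inner ℝ (B.opt i) (B.param i)|) = δ →
      B.InfoRatioBound →
      ∀ T : ℕ, T₀ ≤ T →
        B.bayesRegret T ≤
            2 * d * √(T * Real.log (3 + 6 * √(2 * T) / d *
              (β * Real.exp (β * δ) / (1 + Real.exp (β * δ)) ^ 2))) ∧
        2 * d * √(T * Real.log (3 + 6 * √(2 * T) / d *
              (β * Real.exp (β * δ) / (1 + Real.exp (β * δ)) ^ 2))) ≤
            2 * d * √(T * Real.log (3 + 3 * √(2 * T) / (2 * d) * min δ⁻¹ β)) := by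
  set L := β * Real.exp (β * δ) / (1 + Real.exp (β * δ)) ^ 2 with hL
  have hL0 : 0 < L := by positivity
  set C := 6 * √2 / d * L with hCdef
  obtain ⟨T₀, hT₀⟩ := exists_nat_ge (max 1 (max (2 / C ^ 2) (Real.exp (4 * β ^ 2) / C)) ^ 2)
  refine ⟨T₀, fun B ha hθ hinf hB T hT => ⟨?_, ?_⟩⟩
  · have hd : d ≠ 0 := by
      rintro rfl
      have h0 : ∀ i, |inner ℝ (B.opt i) (B.param i)| = 0 := fun i => by
        -- In dimension 0 every inner product vanishes, so the infimum would be 0 instead of δ.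
        rw [Subsingleton.elim (B.opt i) 0, inner_zero_left, abs_zero]
      simp only [h0, Real.iInf_const_zero] at hinf
      exact hδ.ne hinf
    have hd' : (0 : ℝ) < d := Nat.cast_pos.2 (Nat.pos_of_ne_zero hd)
    have hC : 0 < C := by positivity
    have hu : max 1 (max (2 / C ^ 2) (Real.exp (4 * β ^ 2) / C)) ≤ √T :=
      Real.le_sqrt_of_sq_le (hT₀.trans (Nat.cast_le.2 hT))
    simp only [max_le_iff] at hu
    obtain ⟨hu1, hu2, hu3⟩ := hu
    have hu0 : 0 < √(T : ℝ) := one_pos.trans_le hu1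
    have hN : 0 < ⌈√(T : ℝ)⌉₊ := Nat.ceil_pos.2 hu0
    obtain ⟨ψ, hψ⟩ := B.exists_isPartition hβ.le ha hθ hN
    have hceil := Nat.le_ceil √(T : ℝ)
    have hceil' := Nat.ceil_lt_add_one hu0.le
    have hlog : Real.log ((2 * ⌈√(T : ℝ)⌉₊ + 1 : ℕ) ^ d : ℕ) ≤ d * Real.log (2 * √T + 3) := by
      rw [Nat.cast_pow, Real.log_pow]
      refine mul_le_mul_of_nonneg_left (Real.log_le_log (by positivity) ?_) hd'.le
      push_cast
      linarith
    have harg : 6 * √(2 * T) / d * L = C * √T := by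
      rw [hCdef, Real.sqrt_mul two_pos.le]
      ring
    have hε : 2 * β * (d / ⌈√(T : ℝ)⌉₊) ≤ 2 * β * (d / √T) := by gcongr
    calc B.bayesRegret T
        ≤ √(T * (d / 2 * Real.log ((2 * ⌈√(T : ℝ)⌉₊ + 1 : ℕ) ^ d : ℕ))) +
            T * (2 * β * (d / ⌈√(T : ℝ)⌉₊)) :=
          B.bayesRegret_le hB (by positivity) hψ T
      _ ≤ √(T * (d / 2 * (d * Real.log (2 * √T + 3)))) + T * (2 * β * (d / √T)) := by gcongr
      _ = d * √T * (√(Real.log (2 * √T + 3) / 2) + 2 * β) := by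
          have h1 : (T : ℝ) * (d / 2 * (d * Real.log (2 * √T + 3))) =
              (d ^ 2 * T) * (Real.log (2 * √T + 3) / 2) := by ring
          rw [h1, Real.sqrt_mul (by positivity), Real.sqrt_mul (by positivity),
            Real.sqrt_sq hd'.le]
          have h2 : (T : ℝ) * (2 * β * (d / √T)) = d * √T * (2 * β) := by
            nth_rewrite 1 [← Real.mul_self_sqrt (Nat.cast_nonneg T)]
            field_simp
          rw [h2]
          ring
      _ ≤ d * √T * (2 * √(Real.log (3 + C * √T))) := by
          gcongr
          exact sqrt_log_add_le hC hu2 hu3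
      _ = 2 * d * √(T * Real.log (3 + 6 * √(2 * T) / d * L)) := by
          rw [harg, Real.sqrt_mul (Nat.cast_nonneg T)]
          ring
  · have hLm := logisticSlope_le hβ hδ
    have harg : 6 * √(2 * T) / d * L ≤ 3 * √(2 * T) / (2 * d) * min δ⁻¹ β := calc
      6 * √(2 * T) / d * L ≤ 6 * √(2 * T) / d * (1 / 4 * min δ⁻¹ β) := by gcongr
      _ = 3 * √(2 * T) / (2 * d) * min δ⁻¹ β := by ring
    refine mul_le_mul_of_nonneg_left (Real.sqrt_le_sqrt (mul_le_mul_of_nonneg_left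
      (Real.log_le_log (by positivity) (by linarith)) (Nat.cast_nonneg T))) (by positivity)
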